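/- Let $d\ge 1$, let $U$ be distributed according to the Haar probability measure $\mu_d$ on the unitary group $\mathbb U(d)$, let $|0\rangle,\dots,|d-1\rangle$ be the standard basis of $\mathbb C^d$, and let $P_U(a)=|\langle a|U|0\rangle|^2=|U_{a0}|^2$, $a\in\{0,\dots,d-1\}$, be the Born distribution of the state $U|0\rangle$. Let $\mathcal C(a)=1/d$ be the uniform distribution on $\{0,\dots,d-1\}$, and write $\mathrm d_{\mathrm{TV}}(P,Q)=\tfrac12\sum_a|P(a)-Q(a)|$ for the total variation distance. Then: 1. For every $d\ge 1$, the random variable $\mathrm d_{\mathrm{TV}}(P_U,\mathcal C)$ is integrable and $$\mathbb E_{U\sim\mu_d}\,\mathrm d_{\mathrm{TV}}(P_U,\mathcal C)=\Bigl(1-\frac1d\Bigr)^d .$$ 2. Consequently $\displaystyle\lim_{d\to\infty}\mathbb E_{U\sim\mu_d}\,\mathrm d_{\mathrm{TV}}(P_U,\mathcal C)=\frac1e$. 3. For every $d\ge 2$ and every $a\in\{0,\dots,d-1\}$, the random variable $P_U(a)=|U_{a0}|^2$ has the $\mathrm{Beta}(1,d-1)$ distribution, that is, the law on $[0,1]$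 with density $(d-1)(1-v)^{d-2}$. -/

import Mathlib

open scoped Matrix
open MeasureTheory

namespace HaarBorn

/-- The unitary group `U(d)`, as Mathlib's group of unitary complex `d × d` matrices. -/
abbrev UGroup (d : ℕ) : Type := Matrix.unitaryGroup (Fin d) ℂ

/-- `U(d)` carries the Borel `σ`-algebra of its topology (the one inherited from `ℂ^(d × d)`). -/
noncomputable instance instMeasurableSpaceUGroup (d : ℕ) : MeasurableSpace (UGroup d) := borel _

instance instBorelSpaceUGroup (d : ℕ) : BorelSpace (UGroup d) := ⟨rfl⟩

instance instCompactSpaceUGroup (d : ℕ) : CompactSpace (UGroup d) := by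
  have hbox : IsCompact {A : Matrix (Fin d) (Fin d) ℂ |
      ∀ i ∈ Set.univ, A i ∈ {v : Fin d → ℂ | ∀ j ∈ Set.univ, v j ∈ Metric.closedBall (0 : ℂ) 1}} :=
    isCompact_univ_pi
      (s := fun _ : Fin d => {v : Fin d → ℂ | ∀ j ∈ Set.univ, v j ∈ Metric.closedBall (0 : ℂ) 1})
      (fun _ => isCompact_univ_pi (s := fun _ : Fin d => Metric.closedBall (0 : ℂ) 1)
        (fun _ => isCompact_closedBall 0 1))
  have hclosed : IsClosed (Matrix.unitaryGroup (Fin d) ℂ : Set (Matrix (Fin d) (Fin d) ℂ)) := by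
    have h : (Matrix.unitaryGroup (Fin d) ℂ : Set (Matrix (Fin d) (Fin d) ℂ)) =
        {A | A * star A = 1} := by
      ext A
      exact Matrix.mem_unitaryGroup_iff
    rw [h]
    exact isClosed_eq (by fun_prop) continuous_const
  refine isCompact_iff_compactSpace.mp (hbox.of_isClosed_subset hclosed ?_)
  intro A hA i _ j _
  simpa using entry_norm_bound_of_unitary hA i j

/-- The Haar probability measure on `U(d)`: the Haar measure giving mass `1` to the whole group. -/
noncomputable def haarU (d : ℕ) : Measure (UGroup d) := Measure.haarMeasure ⊤

instance instIsHaarMeasureHaarU (d : ℕ) : (haarU d).IsHaarMeasure :=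
  inferInstanceAs (Measure.haarMeasure ⊤).IsHaarMeasure

instance instIsProbabilityMeasureHaarU (d : ℕ) : IsProbabilityMeasure (haarU d) :=
  ⟨Measure.haarMeasure_self⟩

/-- The computational basis vector `|a⟩` of `ℂ^d`. -/
def ket {d : ℕ} (a : Fin d) : Fin d → ℂ := Pi.single a 1

/-- The output state `U|0⟩`. -/
def outputState {d : ℕ} [NeZero d] (U : UGroup d) : Fin d → ℂ :=
  (U : Matrix (Fin d) (Fin d) ℂ) *ᵥ ket 0

/-- The Born distribution `P_U(a) = |⟨a|U|0⟩|²` of the state `U|0⟩`. -/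
noncomputable def born {d : ℕ} [NeZero d] (U : UGroup d) (a : Fin d) : ℝ :=
  ‖star (ket a) ⬝ᵥ outputState U‖ ^ 2

/-- The uniform distribution on `d` outcomes. -/
noncomputable def uniform (d : ℕ) (_ : Fin d) : ℝ := 1 / d

/-- The total variation distance of two distributions on a finite set, given by their
probability mass functions. -/
noncomputable def tvDist {X : Type*} [Fintype X] (P Q : X → ℝ) : ℝ :=
  1 / 2 * ∑ x, |P x - Q x|

/-- The Born probabilities are the squared absolute values of the entries of the column `0`. -/
theorem born_eq {d : ℕ} [NeZero d] (U : UGroup d) (a : Fin d) :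
    born U a = ‖(U : Matrix (Fin d) (Fin d) ℂ) a 0‖ ^ 2 := by
  simp [born, outputState, ket]

end HaarBorn

namespace HaarBorn

/-! Everything follows from one tail: under Haar measure `|U_{a0}|²` exceeds `t ∈ [0, 1)` with
probability `(1 - t) ^ (d - 1)`. It is obtained by comparison with a Gaussian vector `z`, whose
direction is distributed like a Haar column. In `haarU_tail_mul_gauss_univ`, the event `t |Uz|² <
|(Uz)_a|²` is measured in two orders. Integrating over `z` first removes `U`, because the Gaussian
is unitarily invariant. Integrating over `U` first removes `z`, because `z` is a multiple of some
`V|0⟩` and Haar measure is right invariant. The Gaussian side is explicit (`gauss_tail`).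

Since both distributions have total mass one, the total variation distance is the sum of the
positive parts `(|U_{a0}|² - 1/d)⁺`. Integrating the tail from `1/d` to `1` gives `(1 - 1/d) ^ d /
d` for each of the `d` outcomes. The same tail is that of `Beta(1, d - 1)`, which identifies the
law. -/

/-- The squared Euclidean norm on `ℂ^d`. -/
noncomputable def normSq {d : ℕ} (z : Fin d → ℂ) : ℝ := ∑ i, ‖z i‖ ^ 2

theorem continuous_normSq {d : ℕ} : Continuous (normSq (d := d)) := by
  unfold normSq; fun_prop

theorem normSq_nonneg {d : ℕ} (z : Fin d → ℂ) : 0 ≤ normSq z :=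
  Finset.sum_nonneg fun _ _ => sq_nonneg _

theorem normSq_eq_zero {d : ℕ} {z : Fin d → ℂ} : normSq z = 0 ↔ z = 0 := by
  rw [normSq, Finset.sum_eq_zero_iff_of_nonneg fun _ _ => sq_nonneg _]
  simp [funext_iff]

theorem ofReal_normSq {d : ℕ} (z : Fin d → ℂ) : (normSq z : ℂ) = star z ⬝ᵥ z := by
  simp [normSq, dotProduct, Complex.conj_mul']

/-! ### Unitary invariance of Lebesgue measure -/

theorem normSq_mulVec {d : ℕ} (U : UGroup d) (z : Fin d → ℂ) :
    normSq ((U : Matrix (Fin d) (Fin d) ℂ) *ᵥ z) = normSq z := by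
  have hU : star (U : Matrix (Fin d) (Fin d) ℂ) * U = 1 := Matrix.mem_unitaryGroup_iff'.1 U.2
  have h : (normSq ((U : Matrix (Fin d) (Fin d) ℂ) *ᵥ z) : ℂ) = normSq z := by
    rw [ofReal_normSq, ofReal_normSq, Matrix.star_mulVec, Matrix.dotProduct_mulVec,
      Matrix.vecMul_vecMul, ← Matrix.star_eq_conjTranspose, hU, Matrix.vecMul_one]
  exact_mod_cast h

/-- The Euclidean unit ball is mapped onto itself and has finite positive volume, which forces the
real determinant to have absolute value one. -/
theorem measurePreserving_mulVec {d : ℕ} (U : UGroup d) :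
    MeasurePreserving (fun z : Fin d → ℂ => (U : Matrix (Fin d) (Fin d) ℂ) *ᵥ z) := by
  let f : (Fin d → ℂ) →ₗ[ℝ] (Fin d → ℂ) :=
    (Matrix.mulVecLin (U : Matrix (Fin d) (Fin d) ℂ)).restrictScalars ℝ
  have hf : ∀ z, f z = (U : Matrix (Fin d) (Fin d) ℂ) *ᵥ z := fun _ => rfl
  let B : Set (Fin d → ℂ) := {z | normSq z ≤ 1}
  have himage : f '' B = B := by
    ext z
    constructor
    · rintro ⟨w, hw, rfl⟩
      simpa only [B, Set.mem_ofPred_eq, hf, normSq_mulVec] using hw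
    · intro hz
      refine ⟨((U⁻¹ : UGroup d) : Matrix (Fin d) (Fin d) ℂ) *ᵥ z, ?_, ?_⟩
      · simpa only [B, Set.mem_ofPred_eq, normSq_mulVec] using hz
      · rw [hf, Matrix.mulVec_mulVec, ← Submonoid.coe_mul, mul_inv_cancel]
        simp
  have hfin : volume B ≠ ⊤ := by
    -- The norm on `Fin d → ℂ` is the sup norm, whose closed unit ball contains the Euclidean one.
    refine ((Metric.isBounded_closedBall (x := (0 : Fin d → ℂ)) (r := 1)).subset ?_).measure_lt_top.ne
    intro z hz
    rw [mem_closedBall_zero_iff, pi_norm_le_iff_of_nonneg zero_le_one]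
    intro i
    have h1 : ‖z i‖ ^ 2 ≤ normSq z :=
      Finset.single_le_sum (f := fun i => ‖z i‖ ^ 2) (fun _ _ => sq_nonneg _) (Finset.mem_univ i)
    have h2 : normSq z ≤ 1 := hz
    nlinarith [norm_nonneg (z i)]
  have hpos : volume B ≠ 0 := by
    have hopen : IsOpen {z : Fin d → ℂ | normSq z < 1} :=
      isOpen_lt continuous_normSq continuous_const
    have h0 : 0 < volume {z : Fin d → ℂ | normSq z < 1} :=
      hopen.measure_pos _ ⟨0, by simp [normSq]⟩
    exact (h0.trans_le (measure_mono fun z (hz : normSq z < 1) => hz.le)).ne'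
  have hdet : ENNReal.ofReal |LinearMap.det f| = 1 := by
    have h := Measure.addHaar_image_linearMap volume f B
    rw [himage] at h
    exact (ENNReal.mul_eq_right hpos hfin).1 h.symm
  have hdet' : |LinearMap.det f| = 1 := by
    simpa using hdet
  have hne : LinearMap.det f ≠ 0 := by
    intro h; simp [h] at hdet'
  refine ⟨by fun_prop, ?_⟩
  have h := Measure.map_linearMap_addHaar_eq_smul_addHaar (volume : Measure (Fin d → ℂ)) hne
  rw [abs_inv, hdet', inv_one, ENNReal.ofReal_one, one_smul] at h
  exact h

/-- The normalised vector extends to an orthonormal basis, whose members are the columns of `V`. For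
`z = 0` the scalar vanishes and any `V` serves. -/
theorem exists_eq_smul_mulVec_ket {d : ℕ} [NeZero d] (z : Fin d → ℂ) :
    ∃ V : UGroup d, z = (√(normSq z) : ℂ) • ((V : Matrix (Fin d) (Fin d) ℂ) *ᵥ ket 0) := by
  by_cases hz : z = 0
  · exact ⟨1, by simp [hz, normSq]⟩
  have hN : 0 < normSq z := (normSq_nonneg z).lt_of_ne' (mt normSq_eq_zero.1 hz)
  let w : EuclideanSpace ℂ (Fin d) := WithLp.toLp 2 ((√(normSq z) : ℂ)⁻¹ • z)
  have hw : ‖w‖ = 1 := by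
    have h : ‖w‖ ^ 2 = 1 := by
      rw [EuclideanSpace.norm_sq_eq]
      simp only [w, Pi.smul_apply, smul_eq_mul, norm_mul, mul_pow, ← Finset.mul_sum, norm_inv,
        Complex.norm_real, Real.norm_eq_abs, inv_pow, sq_abs, Real.sq_sqrt hN.le]
      exact inv_mul_cancel₀ hN.ne'
    nlinarith [norm_nonneg w]
  obtain ⟨b, hb⟩ := Orthonormal.exists_orthonormalBasis_extension_of_card_eq
    (𝕜 := ℂ) (E := EuclideanSpace ℂ (Fin d)) (ι := Fin d) (by simp)
    (v := fun _ => w) (s := {0}) (by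
      constructor
      · intro i; exact hw
      · intro i j hij; exact absurd (Subsingleton.elim i j) hij)
  refine ⟨⟨_, (EuclideanSpace.basisFun (Fin d) ℂ).toMatrix_orthonormalBasis_mem_unitary b⟩, ?_⟩
  ext i
  have hs : (√(normSq z) : ℂ) ≠ 0 := by
    simpa using (Real.sqrt_pos.2 hN).ne'
  simp [ket, Module.Basis.toMatrix_apply, hb 0 rfl, w, hs]

theorem mulVec_apply_eq_of_eq_smul {d : ℕ} [NeZero d] {z : Fin d → ℂ} {c : ℂ}
    (U V : UGroup d) (hz : z = c • ((V : Matrix (Fin d) (Fin d) ℂ) *ᵥ ket 0)) (a : Fin d) :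
    ((U : Matrix (Fin d) (Fin d) ℂ) *ᵥ z) a =
      c * ((U * V : UGroup d) : Matrix (Fin d) (Fin d) ℂ) a 0 := by
  rw [hz, Matrix.mulVec_smul, Matrix.mulVec_mulVec]
  simp [ket]

/-! ### Right invariance of Haar measure -/

instance (d : ℕ) : SecondCountableTopology (UGroup d) :=
  haveI : SecondCountableTopology (Matrix (Fin d) (Fin d) ℂ) :=
    inferInstanceAs (SecondCountableTopology (Fin d → Fin d → ℂ))
  TopologicalSpace.Subtype.secondCountableTopology _

/-- A right translate is again a Haar probability measure, and that measure is unique. -/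
instance (d : ℕ) : (haarU d).IsMulRightInvariant := by
  refine ⟨fun V => ?_⟩
  have : IsProbabilityMeasure ((haarU d).map (· * V)) :=
    Measure.isProbabilityMeasure_map (measurable_mul_const V).aemeasurable
  exact Measure.isHaarMeasure_eq_of_isProbabilityMeasure _ _

theorem continuous_entry {d : ℕ} (a b : Fin d) :
    Continuous fun U : UGroup d => (U : Matrix (Fin d) (Fin d) ℂ) a b :=
  continuous_subtype_val.matrix_elem a b

/-- With `z = |z| V|0⟩` the condition on `U` becomes the column condition on `U * V`, and right
translation by `V` preserves the measure. -/
theorem haarU_mulVec_tail {d : ℕ} [NeZero d] {z : Fin d → ℂ} (hz : z ≠ 0) (a : Fin d) (t : ℝ) :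
    haarU d {U | t * normSq ((U : Matrix (Fin d) (Fin d) ℂ) *ᵥ z) <
        ‖((U : Matrix (Fin d) (Fin d) ℂ) *ᵥ z) a‖ ^ 2} =
      haarU d {U | t < ‖(U : Matrix (Fin d) (Fin d) ℂ) a 0‖ ^ 2} := by
  obtain ⟨V, hV⟩ := exists_eq_smul_mulVec_ket z
  have hN : 0 < normSq z := (normSq_nonneg z).lt_of_ne' (mt normSq_eq_zero.1 hz)
  rw [← measure_preimage_mul_right (haarU d) V {U | t < ‖(U : Matrix (Fin d) (Fin d) ℂ) a 0‖ ^ 2}]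
  congr 1
  ext U
  rw [Set.mem_ofPred_eq, Set.mem_preimage, Set.mem_ofPred_eq, normSq_mulVec,
    mulVec_apply_eq_of_eq_smul U V hV, norm_mul, mul_pow, Complex.norm_real, Real.norm_eq_abs,
    sq_abs, Real.sq_sqrt hN.le, mul_comm t, mul_lt_mul_iff_right₀ hN]

/-! ### Comparison of Haar and Gaussian measures -/

/-- The unnormalised standard Gaussian measure on `ℂ^d`, with density `exp (-‖z‖²)`. -/
noncomputable def gauss (d : ℕ) : Measure (Fin d → ℂ) :=
  volume.withDensity fun z => ENNReal.ofReal (Real.exp (-normSq z))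

theorem measurable_gaussDensity {d : ℕ} :
    Measurable fun z : Fin d → ℂ => ENNReal.ofReal (Real.exp (-normSq z)) :=
  (ENNReal.continuous_ofReal.comp (Real.continuous_exp.comp continuous_normSq.neg)).measurable

theorem measurePreserving_mulVec_gauss {d : ℕ} (U : UGroup d) :
    MeasurePreserving (fun z : Fin d → ℂ => (U : Matrix (Fin d) (Fin d) ℂ) *ᵥ z)
      (gauss d) (gauss d) := by
  have hU := measurePreserving_mulVec U
  refine ⟨hU.measurable, Measure.ext fun s hs => ?_⟩
  rw [Measure.map_apply hU.measurable hs, gauss, withDensity_apply _ hs,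
    withDensity_apply _ (hU.measurable hs),
    ← hU.setLIntegral_comp_preimage hs measurable_gaussDensity]
  simp_rw [normSq_mulVec]

instance (d : ℕ) : SFinite (gauss d) := by unfold gauss; infer_instance

theorem gauss_singleton_zero {d : ℕ} [NeZero d] : gauss d {0} = 0 :=
  withDensity_absolutelyContinuous _ _ (measure_singleton 0)

theorem haarU_tail_mul_gauss_univ {d : ℕ} [NeZero d] (a : Fin d) (t : ℝ) :
    haarU d {U | t < ‖(U : Matrix (Fin d) (Fin d) ℂ) a 0‖ ^ 2} * gauss d Set.univ =
      gauss d {z | t * normSq z < ‖z a‖ ^ 2} := by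
  let S : Set (UGroup d × (Fin d → ℂ)) :=
    {p | t * normSq ((p.1 : Matrix (Fin d) (Fin d) ℂ) *ᵥ p.2) <
        ‖((p.1 : Matrix (Fin d) (Fin d) ℂ) *ᵥ p.2) a‖ ^ 2}
  have hmv : Continuous fun p : UGroup d × (Fin d → ℂ) =>
      (p.1 : Matrix (Fin d) (Fin d) ℂ) *ᵥ p.2 :=
    (continuous_subtype_val.comp continuous_fst).matrix_mulVec continuous_snd
  have hS : MeasurableSet S :=
    (isOpen_lt (continuous_const.mul (continuous_normSq.comp hmv))
      (((continuous_apply a).comp hmv).norm.pow 2)).measurableSet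
  have h1 : ((haarU d).prod (gauss d)) S = gauss d {z | t * normSq z < ‖z a‖ ^ 2} := by
    rw [Measure.prod_apply hS]
    have hT : MeasurableSet {z : Fin d → ℂ | t * normSq z < ‖z a‖ ^ 2} :=
      (isOpen_lt (continuous_const.mul continuous_normSq)
        ((continuous_apply a).norm.pow 2)).measurableSet
    have h : ∀ U : UGroup d, gauss d (Prod.mk U ⁻¹' S) =
        gauss d {z | t * normSq z < ‖z a‖ ^ 2} := fun U =>
      (measurePreserving_mulVec_gauss U).measure_preimage hT.nullMeasurableSet
    simp [h]
  rw [← h1, Measure.prod_apply_symm hS]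
  have h : ∀ᵐ z ∂gauss d, haarU d ((fun U => (U, z)) ⁻¹' S) =
      haarU d {U | t < ‖(U : Matrix (Fin d) (Fin d) ℂ) a 0‖ ^ 2} := by
    -- The zero vector has no direction, but it is a null set.
    have h0 : ∀ᵐ z ∂gauss d, z ∉ ({0} : Set (Fin d → ℂ)) :=
      measure_eq_zero_iff_ae_notMem.1 gauss_singleton_zero
    filter_upwards [h0] with z hz
    exact haarU_mulVec_tail hz a t
  rw [lintegral_congr_ae h, lintegral_const]

/-! ### Gaussian integrals -/

theorem integral_exp_neg_mul_norm_sq_complex {b : ℝ} (hb : 0 < b) :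
    ∫ x : ℂ, Real.exp (-b * ‖x‖ ^ 2) = Real.pi / b := by
  rw [GaussianFourier.integral_rexp_neg_mul_sq_norm hb, Complex.finrank_real_complex]
  norm_num

theorem integrable_exp_neg_mul_norm_sq_complex {b : ℝ} (hb : 0 < b) :
    Integrable fun x : ℂ => Real.exp (-b * ‖x‖ ^ 2) := by
  by_contra h
  have h1 := integral_exp_neg_mul_norm_sq_complex hb
  -- A non-integrable function has integral `0` by convention, which contradicts `0 < π / b`.
  rw [integral_undef h] at h1
  exact (div_pos Real.pi_pos hb).ne h1

theorem lintegral_exp_neg_mul_normSq (n : ℕ) {b : ℝ} (hb : 0 < b) :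
    ∫⁻ w : Fin n → ℂ, ENNReal.ofReal (Real.exp (-b * normSq w)) =
      ENNReal.ofReal ((Real.pi / b) ^ n) := by
  have hprod : ∀ w : Fin n → ℂ,
      Real.exp (-b * normSq w) = ∏ i, Real.exp (-b * ‖w i‖ ^ 2) := fun w => by
    rw [normSq, Finset.mul_sum, Real.exp_sum]
  simp_rw [hprod]
  rw [volume_pi, ← ofReal_integral_eq_lintegral_ofReal
    (Integrable.fintype_prod fun _ => integrable_exp_neg_mul_norm_sq_complex hb)
    (Filter.Eventually.of_forall fun w => Finset.prod_nonneg fun _ _ => (Real.exp_pos _).le)]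
  congr 1
  refine (integral_fintype_prod_volume_eq_pow fun x : ℂ => Real.exp (-b * ‖x‖ ^ 2)).trans ?_
  rw [integral_exp_neg_mul_norm_sq_complex hb, Fintype.card_fin]

theorem integral_Ioi_mul_exp_neg_sq (r : ℝ) :
    ∫ y in Set.Ioi r, 2 * y * Real.exp (-y ^ 2) = Real.exp (-r ^ 2) := by
  have hint : IntegrableOn (fun y : ℝ => 2 * y * Real.exp (-y ^ 2)) (Set.Ioi r) := by
    have h := ((integrable_mul_exp_neg_mul_sq (b := 1) one_pos).const_mul 2).integrableOn
      (s := Set.Ioi r)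
    refine h.congr_fun (fun y _ => ?_) measurableSet_Ioi
    simp only [neg_mul, one_mul, mul_assoc]
  have hderiv : ∀ y : ℝ, HasDerivAt (fun y => -Real.exp (-y ^ 2)) (2 * y * Real.exp (-y ^ 2)) y :=
    fun y => (hasDerivAt_pow 2 y).fun_neg.exp.fun_neg.congr_deriv (by push_cast; ring)
  have hlim : Filter.Tendsto (fun y : ℝ => -Real.exp (-y ^ 2)) Filter.atTop (nhds 0) := by
    have h : Filter.Tendsto (fun y : ℝ => -y ^ 2) Filter.atTop Filter.atBot :=
      Filter.tendsto_neg_atTop_atBot.comp (Filter.tendsto_pow_atTop two_ne_zero)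
    simpa using (Real.tendsto_exp_atBot.comp h).neg
  rw [integral_Ioi_of_hasDerivAt_of_tendsto' (fun y _ => hderiv y) hint hlim]
  ring

theorem lintegral_gauss_complex_tail {s : ℝ} (hs : 0 ≤ s) :
    ∫⁻ x in {x : ℂ | s < ‖x‖ ^ 2}, ENNReal.ofReal (Real.exp (-‖x‖ ^ 2)) =
      ENNReal.ofReal (Real.pi * Real.exp (-s)) := by
  have hT : MeasurableSet {x : ℂ | s < ‖x‖ ^ 2} :=
    (isOpen_lt continuous_const (continuous_norm.pow 2)).measurableSet
  have hint : Integrable fun x : ℂ => Real.exp (-‖x‖ ^ 2) := by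
    simpa using integrable_exp_neg_mul_norm_sq_complex one_pos
  rw [← ofReal_integral_eq_lintegral_ofReal hint.integrableOn
    (Filter.Eventually.of_forall fun _ => (Real.exp_pos _).le), ← integral_indicator hT]
  congr 1
  have hball : volume.real (Metric.ball (0 : ℂ) 1) = Real.pi := by
    simp [Measure.real]
  -- Polar coordinates: the Jacobian factor `y` makes the radial integrand an exact derivative.
  have h := integral_fun_norm_addHaar (volume : Measure ℂ)
    ((Set.Ioi (√s)).indicator fun y => Real.exp (-y ^ 2))
  have hind : ∀ x : ℂ, ({x : ℂ | s < ‖x‖ ^ 2}.indicator fun x => Real.exp (-‖x‖ ^ 2)) x =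
      (Set.Ioi (√s)).indicator (fun y => Real.exp (-y ^ 2)) ‖x‖ := fun x => by
    have hiff : s < ‖x‖ ^ 2 ↔ √s < ‖x‖ := by
      rw [← Real.sqrt_lt_sqrt_iff hs, Real.sqrt_sq (norm_nonneg x)]
    simp only [Set.indicator, Set.mem_ofPred_eq, Set.mem_Ioi, hiff]
  simp_rw [hind]
  rw [h, hball, Complex.finrank_real_complex]
  have h2 : ∀ y : ℝ, y ^ (2 - 1) • (Set.Ioi (√s)).indicator (fun y => Real.exp (-y ^ 2)) y =
      (Set.Ioi (√s)).indicator (fun y => y * Real.exp (-y ^ 2)) y := fun y => by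
    by_cases hy : y ∈ Set.Ioi (√s) <;> simp [hy]
  simp_rw [h2]
  rw [setIntegral_indicator measurableSet_Ioi, Set.Ioi_inter_Ioi,
    sup_eq_right.2 (Real.sqrt_nonneg s)]
  have h3 := integral_Ioi_mul_exp_neg_sq (√s)
  simp_rw [mul_assoc] at h3
  rw [integral_const_mul, Real.sq_sqrt hs] at h3
  rw [← h3]
  simp
  ring

theorem gauss_univ (d : ℕ) : gauss d Set.univ = ENNReal.ofReal (Real.pi ^ d) := by
  have h := lintegral_exp_neg_mul_normSq d one_pos
  rw [gauss, withDensity_apply _ MeasurableSet.univ, Measure.restrict_univ]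
  simpa using h

theorem normSq_eq_add_removeNth {n : ℕ} (z : Fin (n + 1) → ℂ) (a : Fin (n + 1)) :
    normSq z = ‖z a‖ ^ 2 + normSq (a.removeNth z) :=
  Fin.sum_univ_succAbove _ a

/-- For fixed other coordinates `w`, the integral over `z a` is `π exp (-c |w|²)`. What remains is a
Gaussian integral in `n` variables with parameter `1 + c`. -/
theorem gauss_tail {n : ℕ} (a : Fin (n + 1)) {t : ℝ} (h0 : 0 ≤ t) (h1 : t < 1) :
    gauss (n + 1) {z | t * normSq z < ‖z a‖ ^ 2} =
      ENNReal.ofReal (Real.pi ^ (n + 1) * (1 - t) ^ n) := by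
  have ht : 0 < 1 - t := sub_pos.2 h1
  -- Solving `t (|z_a|² + |w|²) < |z_a|²` for `|z_a|²` gives this slope.
  let c : ℝ := t / (1 - t)
  have hc0 : 0 ≤ c := div_nonneg h0 ht.le
  have hc : 1 + c = (1 - t)⁻¹ := by simp only [c]; field_simp; ring
  have hT : MeasurableSet {z : Fin (n + 1) → ℂ | t * normSq z < ‖z a‖ ^ 2} :=
    (isOpen_lt (continuous_const.mul continuous_normSq)
      ((continuous_apply a).norm.pow 2)).measurableSet
  let S : Set (ℂ × (Fin n → ℂ)) := {p | c * normSq p.2 < ‖p.1‖ ^ 2}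
  have hS : MeasurableSet S :=
    (isOpen_lt (continuous_const.mul (continuous_normSq.comp continuous_snd))
      (continuous_fst.norm.pow 2)).measurableSet
  let F : ℂ × (Fin n → ℂ) → ENNReal := S.indicator fun p =>
    ENNReal.ofReal (Real.exp (-normSq p.2)) * ENNReal.ofReal (Real.exp (-‖p.1‖ ^ 2))
  have hF : Measurable F := by
    refine Measurable.indicator ?_ hS
    refine (measurable_gaussDensity.comp measurable_snd).mul ?_
    fun_prop
  have key : ∀ z : Fin (n + 1) → ℂ,
      ({z : Fin (n + 1) → ℂ | t * normSq z < ‖z a‖ ^ 2}.indicator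
        fun z => ENNReal.ofReal (Real.exp (-normSq z))) z =
      F (MeasurableEquiv.piFinSuccAbove (fun _ => ℂ) a z) := fun z => by
    have hz : MeasurableEquiv.piFinSuccAbove (fun _ => ℂ) a z = (z a, a.removeNth z) := rfl
    have hiff : t * normSq z < ‖z a‖ ^ 2 ↔ c * normSq (a.removeNth z) < ‖z a‖ ^ 2 := by
      rw [normSq_eq_add_removeNth z a, div_mul_eq_mul_div, div_lt_iff₀ ht]
      constructor <;> intro h <;> linarith
    rw [hz]
    simp only [F, S, Set.indicator, Set.mem_ofPred_eq, hiff]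
    rw [← ENNReal.ofReal_mul (Real.exp_pos _).le, ← Real.exp_add, normSq_eq_add_removeNth z a,
      neg_add_rev]
  rw [gauss, withDensity_apply _ hT, ← lintegral_indicator hT]
  simp_rw [key]
  rw [(volume_preserving_piFinSuccAbove (fun _ => ℂ) a).lintegral_comp hF,
    Measure.volume_eq_prod, lintegral_prod_symm _ hF.aemeasurable]
  have inner : ∀ w : Fin n → ℂ, ∫⁻ x : ℂ, F (x, w) =
      ENNReal.ofReal Real.pi * ENNReal.ofReal (Real.exp (-(1 + c) * normSq w)) := fun w => by
    have hTw : MeasurableSet {x : ℂ | c * normSq w < ‖x‖ ^ 2} :=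
      (isOpen_lt continuous_const (continuous_norm.pow 2)).measurableSet
    have hFw : ∀ x : ℂ, F (x, w) = {x : ℂ | c * normSq w < ‖x‖ ^ 2}.indicator
        (fun x => ENNReal.ofReal (Real.exp (-normSq w)) *
          ENNReal.ofReal (Real.exp (-‖x‖ ^ 2))) x := fun x => rfl
    simp_rw [hFw]
    rw [lintegral_indicator hTw, lintegral_const_mul _ (by fun_prop),
      lintegral_gauss_complex_tail (mul_nonneg hc0 (normSq_nonneg w)),
      ← ENNReal.ofReal_mul (Real.exp_pos _).le, ← ENNReal.ofReal_mul Real.pi_pos.le,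
      mul_left_comm, ← Real.exp_add]
    ring_nf
  simp_rw [inner]
  have hmeas : Measurable fun w : Fin n → ℂ =>
      ENNReal.ofReal (Real.exp (-(1 + c) * normSq w)) :=
    (ENNReal.continuous_ofReal.comp (Real.continuous_exp.comp
      (continuous_const.mul continuous_normSq))).measurable
  rw [lintegral_const_mul _ hmeas, lintegral_exp_neg_mul_normSq n (by linarith),
    ← ENNReal.ofReal_mul Real.pi_pos.le, hc, div_inv_eq_mul, mul_pow, pow_succ']
  ring_nf

/-! ### Tails under Haar measure and total variation -/

/-- The tail of the Born probability of one outcome under the Haar measure. -/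
theorem haarU_tail {n : ℕ} (a : Fin (n + 1)) {t : ℝ} (h0 : 0 ≤ t) (h1 : t < 1) :
    haarU (n + 1) {U | t < ‖(U : Matrix (Fin (n + 1)) (Fin (n + 1)) ℂ) a 0‖ ^ 2} =
      ENNReal.ofReal ((1 - t) ^ n) := by
  have h := haarU_tail_mul_gauss_univ a t
  have hpi : 0 < Real.pi ^ (n + 1) := pow_pos Real.pi_pos _
  rw [gauss_tail a h0 h1, gauss_univ, mul_comm (Real.pi ^ (n + 1)),
    ENNReal.ofReal_mul (pow_nonneg (sub_pos.2 h1).le n)] at h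
  exact (ENNReal.mul_left_inj (ENNReal.ofReal_pos.2 hpi).ne' ENNReal.ofReal_ne_top).1 h

theorem continuous_norm_sq_entry {d : ℕ} (a b : Fin d) :
    Continuous fun U : UGroup d => ‖(U : Matrix (Fin d) (Fin d) ℂ) a b‖ ^ 2 :=
  (continuous_entry a b).norm.pow 2

theorem norm_sq_entry_le_one {d : ℕ} (U : UGroup d) (a b : Fin d) :
    ‖(U : Matrix (Fin d) (Fin d) ℂ) a b‖ ^ 2 ≤ 1 :=
  pow_le_one₀ (norm_nonneg _) (entry_norm_bound_of_unitary U.2 a b)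

theorem sum_norm_sq_column {d : ℕ} [NeZero d] (U : UGroup d) :
    ∑ a, ‖(U : Matrix (Fin d) (Fin d) ℂ) a 0‖ ^ 2 = 1 := by
  have h := normSq_mulVec U (ket 0)
  simpa [normSq, ket, Pi.single_apply, apply_ite] using h

theorem haarU_tail_of_one_le {d : ℕ} [NeZero d] (a : Fin d) {t : ℝ} (ht : 1 ≤ t) :
    haarU d {U | t < ‖(U : Matrix (Fin d) (Fin d) ℂ) a 0‖ ^ 2} = 0 := by
  convert measure_empty (μ := haarU d)
  exact Set.eq_empty_of_forall_notMem fun U hU =>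
    (ht.trans_lt hU).not_ge (norm_sq_entry_le_one U a 0)

/-- The differences sum to zero, so in `|x| = 2 max x 0 - x` the linear term cancels. -/
theorem tvDist_born_uniform {d : ℕ} [NeZero d] (U : UGroup d) :
    tvDist (born U) (uniform d) =
      ∑ a, max (‖(U : Matrix (Fin d) (Fin d) ℂ) a 0‖ ^ 2 - 1 / (d : ℝ)) 0 := by
  have habs : ∀ x : ℝ, |x| = 2 * max x 0 - x := fun x => by
    rcases le_total x 0 with h | h
    · rw [abs_of_nonpos h, max_eq_right h]; ring
    · rw [abs_of_nonneg h, max_eq_left h]; ring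
  have hd : (d : ℝ) ≠ 0 := NeZero.ne _
  simp only [tvDist, born_eq, uniform, habs, Finset.sum_sub_distrib, sum_norm_sq_column,
    ← Finset.mul_sum, Finset.sum_const, Finset.card_univ, Fintype.card_fin, nsmul_eq_mul,
    mul_one_div_cancel hd]
  ring

theorem integrable_excess {d : ℕ} (a b : Fin d) (c : ℝ) :
    Integrable (fun U : UGroup d => max (‖(U : Matrix (Fin d) (Fin d) ℂ) a b‖ ^ 2 - c) 0)
      (haarU d) := by
  have hcont : Continuous fun U : UGroup d =>
      max (‖(U : Matrix (Fin d) (Fin d) ℂ) a b‖ ^ 2 - c) 0 :=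
    ((continuous_norm_sq_entry a b).sub continuous_const).max continuous_const
  exact hcont.integrable_of_hasCompactSupport (HasCompactSupport.of_compactSpace _)

theorem integral_excess {n : ℕ} (a : Fin (n + 1)) {c : ℝ} (h0 : 0 ≤ c) (h1 : c ≤ 1) :
    ∫ U : UGroup (n + 1),
        max (‖(U : Matrix (Fin (n + 1)) (Fin (n + 1)) ℂ) a 0‖ ^ 2 - c) 0 ∂(haarU (n + 1)) =
      (1 - c) ^ (n + 1) / (n + 1) := by
  -- Layer cake: the mean of a nonnegative variable is the integral of its tail, here supported on
  -- `s < 1 - c`.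
  rw [(integrable_excess a 0 c).integral_eq_integral_meas_lt
    (Filter.Eventually.of_forall fun _ => le_max_right _ _)]
  have htail : ∀ s ∈ Set.Ioi (0 : ℝ), (haarU (n + 1)).real
      {U : UGroup (n + 1) | s <
        max (‖(U : Matrix (Fin (n + 1)) (Fin (n + 1)) ℂ) a 0‖ ^ 2 - c) 0} =
      (Set.Iio (1 - c)).indicator (fun s => (1 - c - s) ^ n) s := fun s hs => by
    have hs0 : 0 < s := hs
    have hset : {U : UGroup (n + 1) | s <
        max (‖(U : Matrix (Fin (n + 1)) (Fin (n + 1)) ℂ) a 0‖ ^ 2 - c) 0} =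
        {U : UGroup (n + 1) | c + s < ‖(U : Matrix (Fin (n + 1)) (Fin (n + 1)) ℂ) a 0‖ ^ 2} := by
      ext U
      simp only [Set.mem_ofPred_eq, lt_max_iff, hs0.not_gt, or_false, lt_sub_iff_add_lt']
    rw [hset, measureReal_def]
    by_cases h : s < 1 - c
    · rw [haarU_tail a (by linarith) (by linarith), Set.indicator_of_mem (Set.mem_Iio.2 h),
        ENNReal.toReal_ofReal (pow_nonneg (by linarith) n), sub_add_eq_sub_sub]
    · rw [haarU_tail_of_one_le a (by linarith),
        Set.indicator_of_notMem (fun h' => h (Set.mem_Iio.1 h')), ENNReal.toReal_zero]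
  rw [setIntegral_congr_fun measurableSet_Ioi htail, setIntegral_indicator measurableSet_Iio,
    Set.Ioi_inter_Iio, ← integral_Ioc_eq_integral_Ioo,
    ← intervalIntegral.integral_of_le (by linarith),
    intervalIntegral.integral_comp_sub_left (fun x => x ^ n), integral_pow]
  simp

theorem integrable_tvDist (d : ℕ) [NeZero d] :
    Integrable (fun U : UGroup d => tvDist (born U) (uniform d)) (haarU d) := by
  simp_rw [tvDist_born_uniform]
  exact integrable_finsetSum _ fun a _ => integrable_excess a 0 _

theorem integral_tvDist (d : ℕ) [NeZero d] :
    ∫ U : UGroup d, tvDist (born U) (uniform d) ∂(haarU d) = (1 - 1 / (d : ℝ)) ^ d := by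
  obtain ⟨n, rfl⟩ := Nat.exists_eq_succ_of_ne_zero (NeZero.ne d)
  have hn : (0 : ℝ) < (n : ℝ) + 1 := by positivity
  simp_rw [tvDist_born_uniform]
  rw [integral_finsetSum _ fun a _ => integrable_excess a 0 _]
  have h : ∀ a : Fin (n + 1), ∫ U : UGroup (n + 1),
      max (‖(U : Matrix (Fin (n + 1)) (Fin (n + 1)) ℂ) a 0‖ ^ 2 - 1 / ((n + 1 : ℕ) : ℝ)) 0
        ∂(haarU (n + 1)) = (1 - 1 / ((n + 1 : ℕ) : ℝ)) ^ (n + 1) / (n + 1) := fun a => by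
    refine integral_excess a (by positivity) ?_
    rw [Nat.cast_succ]
    exact (div_le_one hn).2 (by linarith [Nat.cast_nonneg (α := ℝ) n])
  have hsum := Finset.sum_congr rfl fun (a : Fin (n + 1)) (_ : a ∈ Finset.univ) => h a
  refine hsum.trans ?_
  rw [Finset.sum_const, Finset.card_univ, Fintype.card_fin, nsmul_eq_mul]
  push_cast
  field_simp

theorem tendsto_integral_tvDist :
    Filter.Tendsto
      (fun n : ℕ => ∫ U : UGroup (n + 1), tvDist (born U) (uniform (n + 1)) ∂(haarU (n + 1)))
      Filter.atTop (nhds (1 / Real.exp 1)) := by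
  have h := (Real.tendsto_one_add_div_pow_exp (-1)).comp (Filter.tendsto_add_atTop_nat 1)
  rw [Real.exp_neg, ← one_div] at h
  refine h.congr fun n => ?_
  rw [integral_tvDist, Function.comp_apply, neg_div, sub_eq_add_neg]

/-! ### The Beta law -/

open ProbabilityTheory in
theorem betaMeasure_one_natCast_Ioi (m : ℕ) {t : ℝ} (h0 : 0 ≤ t) (h1 : t ≤ 1) :
    betaMeasure 1 ((m : ℝ) + 1) (Set.Ioi t) = ENNReal.ofReal ((1 - t) ^ (m + 1)) := by
  have hm : (0 : ℝ) < (m : ℝ) + 1 := by positivity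
  -- The normalisation comes from `Γ(m + 2) = (m + 1) Γ(m + 1)`.
  have hbeta : 1 / beta 1 ((m : ℝ) + 1) = m + 1 := by
    rw [beta, Real.Gamma_one, add_comm 1 ((m : ℝ) + 1), Real.Gamma_add_one hm.ne']
    field_simp [(Real.Gamma_pos_of_pos hm).ne']
  have hpdf : ∀ x ∈ Set.Ioi t, betaPDF 1 ((m : ℝ) + 1) x =
      (Set.Iio 1).indicator (fun x => ENNReal.ofReal ((m + 1) * (1 - x) ^ m)) x := fun x hx => by
    by_cases h : x < 1
    · rw [betaPDF_of_pos_lt_one (h0.trans_lt hx) h, Set.indicator_of_mem (Set.mem_Iio.2 h), hbeta]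
      simp
    · rw [betaPDF_eq_zero_of_one_le (not_lt.1 h),
        Set.indicator_of_notMem fun h' => h (Set.mem_Iio.1 h')]
  have hint : IntegrableOn (fun x : ℝ => ((m : ℝ) + 1) * (1 - x) ^ m) (Set.Ioo t 1) :=
    (Continuous.integrableOn_Icc (by fun_prop)).mono_set Set.Ioo_subset_Icc_self
  have hnn : 0 ≤ᵐ[volume.restrict (Set.Ioo t 1)] fun x : ℝ => ((m : ℝ) + 1) * (1 - x) ^ m :=
    (ae_restrict_iff' measurableSet_Ioo).2 (Filter.Eventually.of_forall fun x hx =>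
      mul_nonneg hm.le (pow_nonneg (sub_nonneg.2 hx.2.le) m))
  rw [betaMeasure, withDensity_apply _ measurableSet_Ioi,
    setLIntegral_congr_fun measurableSet_Ioi hpdf, setLIntegral_indicator measurableSet_Iio,
    Set.inter_comm, Set.Ioi_inter_Iio, ← ofReal_integral_eq_lintegral_ofReal hint hnn,
    ← integral_Ioc_eq_integral_Ioo, ← intervalIntegral.integral_of_le h1,
    intervalIntegral.integral_const_mul,
    intervalIntegral.integral_comp_sub_left (fun x => x ^ m), integral_pow]
  congr 1
  simp
  field_simp

/-- Upper tails determine a probability measure on `ℝ`, and the two families of tails agree. -/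
theorem hasLaw_norm_sq_entry {m : ℕ} (a : Fin (m + 2)) :
    ProbabilityTheory.HasLaw
      (fun U : UGroup (m + 2) => ‖(U : Matrix (Fin (m + 2)) (Fin (m + 2)) ℂ) a 0‖ ^ 2)
      (ProbabilityTheory.betaMeasure 1 ((m : ℝ) + 1)) (haarU (m + 2)) := by
  have hX : Measurable fun U : UGroup (m + 2) =>
      ‖(U : Matrix (Fin (m + 2)) (Fin (m + 2)) ℂ) a 0‖ ^ 2 :=
    (continuous_norm_sq_entry a 0).measurable
  have : IsProbabilityMeasure (ProbabilityTheory.betaMeasure 1 ((m : ℝ) + 1)) :=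
    ProbabilityTheory.isProbabilityMeasureBeta one_pos (by positivity)
  have : IsProbabilityMeasure ((haarU (m + 2)).map fun U : UGroup (m + 2) =>
      ‖(U : Matrix (Fin (m + 2)) (Fin (m + 2)) ℂ) a 0‖ ^ 2) :=
    Measure.isProbabilityMeasure_map hX.aemeasurable
  refine ⟨hX.aemeasurable, Measure.ext_of_Iic _ _ fun t => ?_⟩
  rw [← compl_compl (Set.Iic t), Set.compl_Iic, prob_compl_eq_one_sub measurableSet_Ioi,
    prob_compl_eq_one_sub measurableSet_Ioi]
  congr 1
  have hnonneg : ∀ s : ℝ, 0 ≤ s →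
      ((haarU (m + 2)).map fun U : UGroup (m + 2) =>
        ‖(U : Matrix (Fin (m + 2)) (Fin (m + 2)) ℂ) a 0‖ ^ 2) (Set.Ioi s) =
      ProbabilityTheory.betaMeasure 1 ((m : ℝ) + 1) (Set.Ioi s) := fun s hs => by
    have hmap : ((haarU (m + 2)).map fun U : UGroup (m + 2) =>
        ‖(U : Matrix (Fin (m + 2)) (Fin (m + 2)) ℂ) a 0‖ ^ 2) (Set.Ioi s) =
        haarU (m + 2) {U | s < ‖(U : Matrix (Fin (m + 2)) (Fin (m + 2)) ℂ) a 0‖ ^ 2} :=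
      Measure.map_apply hX measurableSet_Ioi
    rw [hmap]
    rcases lt_or_ge s 1 with h | h
    · rw [haarU_tail a hs h, betaMeasure_one_natCast_Ioi m hs h.le]
    · rw [haarU_tail_of_one_le a h]
      refine (measure_mono_null (Set.Ioi_subset_Ioi h) ?_).symm
      rw [betaMeasure_one_natCast_Ioi m zero_le_one le_rfl]
      simp
  rcases le_or_gt 0 t with h | h
  · exact hnonneg t h
  -- For negative `t` both tails equal one, since both laws already give `Set.Ioi 0` full mass.
  · have hone : ∀ ν : Measure ℝ, IsProbabilityMeasure ν → ν (Set.Ioi 0) = 1 → ν (Set.Ioi t) = 1 :=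
      fun ν _ hν => le_antisymm prob_le_one (hν ▸ measure_mono (Set.Ioi_subset_Ioi h.le))
    have hb : ProbabilityTheory.betaMeasure 1 ((m : ℝ) + 1) (Set.Ioi 0) = 1 := by
      rw [betaMeasure_one_natCast_Ioi m le_rfl zero_le_one]
      simp
    rw [hone _ ‹_› ((hnonneg 0 le_rfl).trans hb), hone _ ‹_› hb]

end HaarBorn

theorem mainTheorem3 :
    (∀ (d : ℕ) [NeZero d],
      Integrable (fun U : HaarBorn.UGroup d =>
          HaarBorn.tvDist (HaarBorn.born U) (HaarBorn.uniform d)) (HaarBorn.haarU d) ∧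
        ∫ U : HaarBorn.UGroup d,
          HaarBorn.tvDist (HaarBorn.born U) (HaarBorn.uniform d) ∂(HaarBorn.haarU d) =
            (1 - 1 / (d : ℝ)) ^ d) ∧
    Filter.Tendsto
      (fun n : ℕ => ∫ U : HaarBorn.UGroup (n + 1),
        HaarBorn.tvDist (HaarBorn.born U) (HaarBorn.uniform (n + 1)) ∂(HaarBorn.haarU (n + 1)))
      Filter.atTop (nhds (1 / Real.exp 1)) ∧
    (∀ (d : ℕ) [NeZero d], 2 ≤ d → ∀ a : Fin d,
      ProbabilityTheory.HasLaw
        (fun U : HaarBorn.UGroup d => ‖(U : Matrix (Fin d) (Fin d) ℂ) a 0‖ ^ 2)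
        (ProbabilityTheory.betaMeasure 1 ((d : ℝ) - 1)) (HaarBorn.haarU d)) := by
  refine ⟨fun d _ => ⟨HaarBorn.integrable_tvDist d, HaarBorn.integral_tvDist d⟩,
    HaarBorn.tendsto_integral_tvDist, fun d _ hd a => ?_⟩
  obtain ⟨m, rfl⟩ := Nat.exists_eq_add_of_le' hd
  have hm : ((m + 2 : ℕ) : ℝ) - 1 = (m : ℝ) + 1 := by push_cast; ring
  rw [hm]
  exact HaarBorn.hasLaw_norm_sq_entry a
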